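/- Let $\rho=\{\rho_k : k\ge 1\}$ be a probability distribution on the positive integers with finite average branching factor $\overline{\rho}=\sum_{k\ge 1}(k-1)\rho_k$, and for $\beta\ge 0$, $B>0$ consider the distributional recursion $$ h \stackrel{d}{=} B+\sum_{i=1}^{K-1}\xi(\beta,h_i),\qquad \xi(\beta,h)=\operatorname{atanh}[\tanh(\beta)\tanh(h)], $$ where $K$ has distribution $\rho$ and the $h_i$ are i.i.d. copies of $h$ independent of $K$. Let $h^*_\beta$ denote a random variable whose law is a fixed point of this recursion supported on $[0,\infty)$. Let $\|X-Y\|_{\mathrm{MK}}$ denote the Monge--Kantorovich--Wasserstein distance between the laws of real random variables $X$ and $Y$, that is, the infimum of $\mathbb{E}|X-Y|$ over all couplings of $X$ and $Y$. For any $B>0$ and any finite $\beta_{\max}$ and $\Delta\ge 0$ there exists a finite constant $C=C(\beta_{\max},B,\Delta)$ such that, for every such $\rho$ with $\overline{\rho}\le\Delta$, all $0\le\beta_1,\beta_2\le\beta_{\max}$ and all fixed points $h^*_{\beta_1}$, $h^*_{\beta_2}$ supported on $[0,\infty)$ of the recursions with parameters $(\beta_1,B,\rho)$ and $(\beta_2,B,\rho)$,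 $$ \|\tanh(h^*_{\beta_2})-\tanh(h^*_{\beta_1})\|_{\mathrm{MK}}\le C\,|\beta_2-\beta_1|. $$ -/

import Mathlib

open MeasureTheory
open scoped NNReal ENNReal

noncomputable section

namespace IsingTree

/-- `ξ(β, h) = atanh (tanh β · tanh h)`. -/
def xi (β h : ℝ) : ℝ := Real.artanh (Real.tanh β * Real.tanh h)

/-- The average branching factor `∑_k (k - 1) ρ_k` of a distribution `ρ` with `ρ 0 = 0`. -/
def meanBranching (ρ : PMF ℕ) : ℝ≥0∞ := ∑' k : ℕ, ρ k * ((k - 1 : ℕ) : ℝ≥0∞)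

/-- The law of `B + ∑_{i=1}^{K-1} ξ(β, h_i)`, where `K` has distribution `ρ`, the `h_i` are i.i.d.
with law `Q`, and `K` is independent of the `h_i`. -/
def cavityUpdate (β B : ℝ) (ρ : PMF ℕ) (Q : Measure ℝ) [IsProbabilityMeasure Q] : Measure ℝ :=
  (ρ.toMeasure.prod (Measure.infinitePi fun _ : ℕ => Q)).map
    fun p : ℕ × (ℕ → ℝ) => B + ∑ i ∈ Finset.range (p.1 - 1), xi β (p.2 i)

/-- `Q` is the law of a random variable supported on `[0, ∞)` that is a fixed point of the
distributional recursion `h ↦ B + ∑_{i=1}^{K-1} ξ(β, h_i)`. -/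
structure IsCavityFixedPoint (β B : ℝ) (ρ : PMF ℕ) (Q : Measure ℝ) [IsProbabilityMeasure Q] :
    Prop where
  supported : Q (Set.Iio 0) = 0
  fixed : cavityUpdate β B ρ Q = Q

/-- The Monge-Kantorovich-Wasserstein distance between two laws on `ℝ`: the infimum of
`E|X - Y|` over all couplings of the two laws. -/
def mkDist (μ ν : Measure ℝ) : ℝ≥0∞ :=
  ⨅ (π : Measure (ℝ × ℝ)) (_ : π.map Prod.fst = μ ∧ π.map Prod.snd = ν),
    ∫⁻ p, ENNReal.ofReal |p.1 - p.2| ∂π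

end IsingTree

end

namespace IsingTree

open Real

/-! ### Calculus of `tanh`. -/

section Hyperbolic

/-! Start from the product of the two fixed-point laws and apply the recursion to pairs, sharing the
offspring number; the marginals never change. Keep track of a `t` such that the messages `ξ(β₁, h₁)`
and `ξ(β₂, h₂)` almost surely agree up to the factor `t`. Concavity of `ξ` in each argument and the
field `B > 0` improve `t` to `r (t + (1 - t) c)` at each step (`messagesWithin_pairField`). Here `r`
is the ratio of the smaller `β` to the larger, and `c > 0` depends only on `βmax` and `B`. Hence `1
- t` is at most `(1 - r) / c` plus a geometric error (`one_sub_ratio_le`).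

With `M` the larger `β`, messages are at most `M`, so one more step bounds the distance by the mean
branching times `M (1 - t)` (`mkDist_map_tanh_le`). Since `M (1 - r) = |β₂ - β₁|`, letting the
number of steps grow gives the claim with constant `Δ / c`. -/

theorem hasDerivAt_tanh (x : ℝ) : HasDerivAt tanh (1 / cosh x ^ 2) x := by
  have h := (hasDerivAt_sinh x).div (hasDerivAt_cosh x) (cosh_pos x).ne'
  have e : tanh = sinh / cosh := funext tanh_eq_sinh_div_cosh
  rw [e]
  refine h.congr_deriv ?_
  rw [← cosh_sq_sub_sinh_sq x]
  ring

theorem monotone_tanh : Monotone tanh :=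
  monotone_of_deriv_nonneg (fun x => (hasDerivAt_tanh x).differentiableAt) fun x => by
    rw [(hasDerivAt_tanh x).deriv]; positivity

theorem tanh_nonneg_of_nonneg {x : ℝ} (hx : 0 ≤ x) : 0 ≤ tanh x := by
  simpa using monotone_tanh hx

theorem lipschitzWith_one_tanh : LipschitzWith 1 tanh :=
  lipschitzWith_of_nnnorm_deriv_le (fun x => (hasDerivAt_tanh x).differentiableAt) fun x => by
    rw [(hasDerivAt_tanh x).deriv, ← NNReal.coe_le_coe, coe_nnnorm, Real.norm_eq_abs,
      abs_of_nonneg (by positivity), NNReal.coe_one, div_le_one (by positivity)]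
    nlinarith [one_le_cosh x]

theorem abs_tanh_sub_tanh_le (x y : ℝ) : |tanh x - tanh y| ≤ |x - y| := by
  simpa [Real.dist_eq] using lipschitzWith_one_tanh.dist_le_mul x y

theorem continuous_tanh : Continuous tanh := lipschitzWith_one_tanh.continuous

theorem tanh_mul_tanh_mem_Ioo (β h : ℝ) : tanh β * tanh h ∈ Set.Ioo (-1 : ℝ) 1 := by
  have h1 : |tanh β| < 1 := abs_lt.2 ⟨neg_one_lt_tanh β, tanh_lt_one β⟩
  have h2 : |tanh h| < 1 := abs_lt.2 ⟨neg_one_lt_tanh h, tanh_lt_one h⟩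
  have : |tanh β * tanh h| < 1 := by
    rw [abs_mul]; nlinarith [abs_nonneg (tanh β), abs_nonneg (tanh h)]
  exact abs_lt.1 this

end Hyperbolic

/-! ### Monotonicity and concavity of the message function. -/

section Xi

theorem xi_comm (β h : ℝ) : xi β h = xi h β := by rw [xi, xi, mul_comm]

theorem xi_zero_right (β : ℝ) : xi β 0 = 0 := by simp [xi]

theorem xi_nonneg {β h : ℝ} (hβ : 0 ≤ β) (hh : 0 ≤ h) : 0 ≤ xi β h :=
  artanh_nonneg (mul_nonneg (tanh_nonneg_of_nonneg hβ) (tanh_nonneg_of_nonneg hh))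

theorem xi_mono {β : ℝ} (hβ : 0 ≤ β) : Monotone (xi β) := fun x y hxy =>
  artanh_le_artanh (tanh_mul_tanh_mem_Ioo β x).1 (tanh_mul_tanh_mem_Ioo β y).2
    (mul_le_mul_of_nonneg_left (monotone_tanh hxy) (tanh_nonneg_of_nonneg hβ))

theorem xi_le_left {β : ℝ} (hβ : 0 ≤ β) (h : ℝ) : xi β h ≤ β := by
  conv_rhs => rw [← artanh_tanh β]
  exact artanh_le_artanh (tanh_mul_tanh_mem_Ioo β h).1 (tanh_lt_one β)
    (mul_le_of_le_one_right (tanh_nonneg_of_nonneg hβ) (tanh_lt_one h).le)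

theorem xi_pos {β h : ℝ} (hβ : 0 < β) (hh : 0 < h) : 0 < xi β h := by
  have key : ∀ x : ℝ, 0 < x → 0 < tanh x := fun x hx => by
    rw [tanh_eq_sinh_div_cosh]
    exact div_pos (sinh_pos_iff.2 hx) (cosh_pos x)
  exact artanh_pos ⟨mul_pos (key β hβ) (key h hh), (tanh_mul_tanh_mem_Ioo β h).2⟩

theorem measurable_xi (β : ℝ) : Measurable (xi β) := by
  have := continuous_tanh.measurable
  unfold xi Real.artanh
  fun_prop

theorem xi_eq_log_cosh (β h : ℝ) :
    xi β h = (log (cosh (h + β)) - log (cosh (h - β))) / 2 := by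
  have hm := tanh_mul_tanh_mem_Ioo β h
  rw [xi, artanh_eq_half_log ⟨hm.1.le, hm.2.le⟩,
    ← log_div (cosh_pos _).ne' (cosh_pos _).ne', one_div_mul_eq_div]
  congr 2
  rw [div_eq_div_iff (by linarith [hm.2]) (cosh_pos _).ne', cosh_add, cosh_sub,
    tanh_eq_sinh_div_cosh, tanh_eq_sinh_div_cosh]
  have h1 := (cosh_pos β).ne'
  have h2 := (cosh_pos h).ne'
  field_simp

theorem hasDerivAt_xi (β h : ℝ) :
    HasDerivAt (xi β) (sinh (2 * β) / (cosh (2 * h) + cosh (2 * β))) h := by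
  have e : xi β = fun h => (log (cosh (h + β)) - log (cosh (h - β))) / 2 :=
    funext (xi_eq_log_cosh β)
  rw [e]
  have h1 := (((hasDerivAt_id h).add_const β).cosh).log (cosh_pos _).ne'
  have h2 := (((hasDerivAt_id h).sub_const β).cosh).log (cosh_pos _).ne'
  refine ((h1.sub h2).div_const 2).congr_deriv ?_
  have p1 := cosh_pos (h + β)
  have p2 := cosh_pos (h - β)
  have s : sinh (2 * β)
      = sinh (h + β) * cosh (h - β) - cosh (h + β) * sinh (h - β) := by
    rw [← sinh_sub]; congr 1; ring
  have c1 : cosh (2 * h)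
      = cosh (h + β) * cosh (h - β) + sinh (h + β) * sinh (h - β) := by
    rw [← cosh_add]; congr 1; ring
  have c2 : cosh (2 * β)
      = cosh (h + β) * cosh (h - β) - sinh (h + β) * sinh (h - β) := by
    rw [← cosh_sub]; congr 1; ring
  have c : cosh (2 * h) + cosh (2 * β) = 2 * (cosh (h + β) * cosh (h - β)) := by
    rw [c1, c2]; ring
  rw [c, s]
  simp only [id]
  field_simp

/-- The derivative depends on `h` only through `cosh (2 * h)` in the denominator, which increases on
`[0, ∞)`. -/
theorem concaveOn_xi {β : ℝ} (hβ : 0 ≤ β) : ConcaveOn ℝ (Set.Ici 0) (xi β) := by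
  refine AntitoneOn.concaveOn_of_deriv (convex_Ici 0)
    (fun x _ => (hasDerivAt_xi β x).continuousAt.continuousWithinAt)
    (fun x _ => (hasDerivAt_xi β x).differentiableAt.differentiableWithinAt) ?_
  intro x hx y hy hxy
  rw [interior_Ici] at hx hy
  rw [(hasDerivAt_xi β x).deriv, (hasDerivAt_xi β y).deriv]
  have hx0 : 0 < x := hx
  have hc : cosh (2 * x) ≤ cosh (2 * y) := by
    rw [cosh_le_cosh, abs_of_pos (by linarith), abs_of_pos (by linarith)]; linarith
  have hs : 0 ≤ sinh (2 * β) := sinh_nonneg_iff.2 (by linarith)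
  have := cosh_pos (2 * x)
  have := cosh_pos (2 * β)
  exact div_le_div_of_nonneg_left hs (by linarith) (by linarith)

theorem mul_xi_add_le {β x y t : ℝ} (hβ : 0 ≤ β) (hx : 0 ≤ x) (hy : 0 ≤ y) (ht : 0 ≤ t)
    (ht' : t ≤ 1) : t * xi β x + (1 - t) * xi β y ≤ xi β (t * x + (1 - t) * y) := by
  simpa using (concaveOn_xi hβ).2 (Set.mem_Ici.2 hx) (Set.mem_Ici.2 hy) ht (sub_nonneg.2 ht')
    (by ring)

/-- By the symmetry `xi_comm`, concavity in `h` is also concavity in `β`; the value at `0` vanishes.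
-/
theorem mul_xi_le_xi_mul {β h t : ℝ} (hβ : 0 ≤ β) (hh : 0 ≤ h) (ht : 0 ≤ t) (ht' : t ≤ 1) :
    t * xi β h ≤ xi (t * β) h := by
  have := mul_xi_add_le hh hβ le_rfl ht ht'
  simp only [xi_zero_right, mul_zero, add_zero] at this
  rwa [xi_comm β, xi_comm (t * β)]

theorem mul_xi_le_xi_of_mul_le {β β' h t : ℝ} (hβ : 0 ≤ β) (hh : 0 ≤ h) (ht : 0 ≤ t)
    (ht' : t ≤ 1) (hle : t * β ≤ β') : t * xi β h ≤ xi β' h :=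
  (mul_xi_le_xi_mul hβ hh ht ht').trans <| by
    rw [xi_comm, xi_comm β']
    exact xi_mono hh hle

/-- Since `ξ(·, B)` is concave and vanishes at `0`, it lies above its chord on `[0, M]`. -/
theorem xi_div_mul_le {β M B : ℝ} (hM : 0 < M) (hB : 0 ≤ B) (hβ : 0 ≤ β) (hβM : β ≤ M) :
    xi M B / M * β ≤ xi β B := by
  have := mul_xi_le_xi_mul hM.le hB (div_nonneg hβ hM.le) ((div_le_one hM).2 hβM)
  rw [div_mul_cancel₀ _ hM.ne'] at this
  calc xi M B / M * β = β / M * xi M B := by ring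
    _ ≤ xi β B := this

/-- Adding a positive field `B` turns a comparison of incoming messages with ratio `t` into a
comparison of outgoing messages with the better ratio `t + (1 - t) c`, up to the ratio `r` of the
two inverse temperatures. -/
theorem mul_xi_add_le_xi_add {β β' B S S' r c t : ℝ} (hβ' : 0 ≤ β') (hB : 0 ≤ B)
    (hS : 0 ≤ S) (hr : 0 ≤ r) (hr' : r ≤ 1) (hrβ : r * β' ≤ β) (ht : 0 ≤ t)
    (ht' : t ≤ 1) (hc : 0 ≤ c) (hcB : c * β' ≤ xi β' B) (hSS' : t * S' ≤ S) (hS' : 0 ≤ S') :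
    r * (t + (1 - t) * c) * xi β' (B + S') ≤ xi β (B + S) := by
  have h1 : (t + (1 - t) * c) * xi β' (B + S')
      ≤ t * xi β' (B + S') + (1 - t) * xi β' B := by
    have : c * xi β' (B + S') ≤ xi β' B :=
      (mul_le_mul_of_nonneg_left (xi_le_left hβ' _) hc).trans hcB
    nlinarith [mul_le_mul_of_nonneg_left this (sub_nonneg.2 ht')]
  have h2 := mul_xi_add_le hβ' (add_nonneg hB hS') hB ht ht'
  -- The convex combination equals `B + t * S'`: the field `B` is not scaled by `t`, which is the
  -- source of the gain.
  have h3 : xi β' (t * (B + S') + (1 - t) * B) ≤ xi β' (B + S) :=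
    xi_mono hβ' (by linarith)
  have h4 := mul_xi_le_xi_of_mul_le hβ' (add_nonneg hB hS) hr hr' hrβ
  calc r * (t + (1 - t) * c) * xi β' (B + S')
      = r * ((t + (1 - t) * c) * xi β' (B + S')) := by ring
    _ ≤ r * xi β' (B + S) := mul_le_mul_of_nonneg_left (h1.trans (h2.trans h3)) hr
    _ ≤ xi β (B + S) := h4

end Xi

/-! ### Couplings iterated along the recursion. -/

section Coupling

/-- The pair of effective fields at the root obtained from pairs of fields at the children, with
the same number of children in both coordinates. -/
noncomputable def pairField (β₁ β₂ B : ℝ) (p : ℕ × (ℕ → ℝ × ℝ)) : ℝ × ℝ :=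
  (B + ∑ i ∈ Finset.range (p.1 - 1), xi β₁ (p.2 i).1,
    B + ∑ i ∈ Finset.range (p.1 - 1), xi β₂ (p.2 i).2)

/-- One step of the recursion on couplings, with the offspring number shared by both systems. -/
noncomputable def pairUpdate (β₁ β₂ B : ℝ) (ρ : PMF ℕ) (κ : Measure (ℝ × ℝ)) [IsProbabilityMeasure κ] :
    Measure (ℝ × ℝ) :=
  (ρ.toMeasure.prod (Measure.infinitePi fun _ : ℕ => κ)).map (pairField β₁ β₂ B)

theorem measurable_sum_range_xi {α : Type*} [MeasurableSpace α] (β B : ℝ) {f : α → ℝ}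
    (hf : Measurable f) :
    Measurable fun p : ℕ × (ℕ → α) =>
      B + ∑ i ∈ Finset.range (p.1 - 1), xi β (f (p.2 i)) := by
  refine measurable_from_prod_countable_right fun k => ?_
  exact measurable_const.add (Finset.measurable_sum (Finset.range (k - 1)) fun i _ =>
    (measurable_xi β).comp (hf.comp (measurable_pi_apply i)))

theorem measurable_pairField (β₁ β₂ B : ℝ) : Measurable (pairField β₁ β₂ B) :=
  (measurable_sum_range_xi β₁ B measurable_fst).prodMk
    (measurable_sum_range_xi β₂ B measurable_snd)

instance isProbabilityMeasure_pairUpdate (β₁ β₂ B : ℝ) (ρ : PMF ℕ) (κ : Measure (ℝ × ℝ))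
    [IsProbabilityMeasure κ] : IsProbabilityMeasure (pairUpdate β₁ β₂ B ρ κ) :=
  Measure.isProbabilityMeasure_map (measurable_pairField β₁ β₂ B).aemeasurable

/-- The recursion driven by the image of a law is the recursion driven by the image of the
fields. -/
theorem cavityUpdate_eq_map {α : Type*} [MeasurableSpace α] (β B : ℝ) (ρ : PMF ℕ)
    (κ : Measure α) [IsProbabilityMeasure κ] {f : α → ℝ} (hf : Measurable f)
    {Q : Measure ℝ} [IsProbabilityMeasure Q] (hQ : κ.map f = Q) :
    (ρ.toMeasure.prod (Measure.infinitePi fun _ : ℕ => κ)).map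
      (fun p : ℕ × (ℕ → α) => B + ∑ i ∈ Finset.range (p.1 - 1), xi β (f (p.2 i)))
      = cavityUpdate β B ρ Q := by
  subst hQ
  rw [cavityUpdate, ← Measure.infinitePi_map_pi (fun _ : ℕ => κ) (fun _ => hf)]
  have hm : Measurable fun (x : ℕ → α) i => f (x i) :=
    measurable_pi_lambda _ fun i => hf.comp (measurable_pi_apply i)
  have hg : Measurable fun p : ℕ × (ℕ → ℝ) =>
      B + ∑ i ∈ Finset.range (p.1 - 1), xi β (p.2 i) :=
    measurable_sum_range_xi β B (f := fun x => x) measurable_id'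
  conv_rhs => rw [← Measure.map_id (μ := ρ.toMeasure)]
  rw [Measure.map_prod_map _ _ measurable_id hm,
    Measure.map_map hg (measurable_id.prodMap hm)]
  rfl

theorem pairUpdate_map_fst {β₁ β₂ B : ℝ} {ρ : PMF ℕ} {Q : Measure ℝ} [IsProbabilityMeasure Q]
    {κ : Measure (ℝ × ℝ)} [IsProbabilityMeasure κ] (hQ : cavityUpdate β₁ B ρ Q = Q)
    (h_prob : κ.map Prod.fst = Q) : (pairUpdate β₁ β₂ B ρ κ).map Prod.fst = Q := by
  rw [pairUpdate, Measure.map_map measurable_fst (measurable_pairField β₁ β₂ B)]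
  exact (cavityUpdate_eq_map β₁ B ρ κ measurable_fst h_prob).trans hQ

theorem pairUpdate_map_snd {β₁ β₂ B : ℝ} {ρ : PMF ℕ} {Q : Measure ℝ} [IsProbabilityMeasure Q]
    {κ : Measure (ℝ × ℝ)} [IsProbabilityMeasure κ] (hQ : cavityUpdate β₂ B ρ Q = Q)
    (h_prob : κ.map Prod.snd = Q) : (pairUpdate β₁ β₂ B ρ κ).map Prod.snd = Q := by
  rw [pairUpdate, Measure.map_map measurable_snd (measurable_pairField β₁ β₂ B)]
  exact (cavityUpdate_eq_map β₂ B ρ κ measurable_snd h_prob).trans hQ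

theorem ae_forall_snd {ρ : PMF ℕ} {κ : Measure (ℝ × ℝ)} [IsProbabilityMeasure κ]
    {P : ℝ × ℝ → Prop} (h : ∀ᵐ q ∂κ, P q) :
    ∀ᵐ p ∂(ρ.toMeasure.prod (Measure.infinitePi fun _ : ℕ => κ)), ∀ i, P (p.2 i) := by
  have h1 : ∀ᵐ x ∂(Measure.infinitePi fun _ : ℕ => κ), ∀ i, P (x i) :=
    ae_all_iff.2 fun i =>
      (measurePreserving_eval_infinitePi (fun _ : ℕ => κ) i).quasiMeasurePreserving.ae h
  exact Measure.quasiMeasurePreserving_snd.ae h1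

/-- Both fields of the pair are nonnegative and their messages agree up to the factor `t`. -/
structure MessagesWithin (β₁ β₂ t : ℝ) (q : ℝ × ℝ) : Prop where
  fst_nonneg : 0 ≤ q.1
  snd_nonneg : 0 ≤ q.2
  le_fst : t * xi β₂ q.2 ≤ xi β₁ q.1
  le_snd : t * xi β₁ q.1 ≤ xi β₂ q.2

theorem measurableSet_messagesWithin (β₁ β₂ t : ℝ) :
    MeasurableSet {q | MessagesWithin β₁ β₂ t q} := by
  have m1 : Measurable fun q : ℝ × ℝ => xi β₁ q.1 := (measurable_xi β₁).comp measurable_fst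
  have m2 : Measurable fun q : ℝ × ℝ => xi β₂ q.2 := (measurable_xi β₂).comp measurable_snd
  have : {q | MessagesWithin β₁ β₂ t q} = {q | 0 ≤ q.1} ∩ ({q | 0 ≤ q.2} ∩
      ({q | t * xi β₂ q.2 ≤ xi β₁ q.1} ∩ {q | t * xi β₁ q.1 ≤ xi β₂ q.2})) := by
    ext q
    exact ⟨fun h => ⟨h.1, h.2, h.3, h.4⟩, fun h => ⟨h.1, h.2.1, h.2.2.1, h.2.2.2⟩⟩
  rw [this]
  exact (measurableSet_le measurable_const measurable_fst).inter
    ((measurableSet_le measurable_const measurable_snd).inter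
      ((measurableSet_le (m2.const_mul t) m1).inter (measurableSet_le (m1.const_mul t) m2)))

theorem messagesWithin_pairField {β₁ β₂ B r c t : ℝ} (hβ₁ : 0 ≤ β₁) (hβ₂ : 0 ≤ β₂) (hB : 0 ≤ B)
    (hr : 0 ≤ r) (hr' : r ≤ 1) (hr₁ : r * β₂ ≤ β₁) (hr₂ : r * β₁ ≤ β₂) (ht : 0 ≤ t) (ht' : t ≤ 1)
    (hc : 0 ≤ c) (hc₁ : c * β₁ ≤ xi β₁ B) (hc₂ : c * β₂ ≤ xi β₂ B) {p : ℕ × (ℕ → ℝ × ℝ)}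
    (hp : ∀ i, MessagesWithin β₁ β₂ t (p.2 i)) :
    MessagesWithin β₁ β₂ (r * (t + (1 - t) * c)) (pairField β₁ β₂ B p) := by
  have n1 : 0 ≤ ∑ i ∈ Finset.range (p.1 - 1), xi β₁ (p.2 i).1 :=
    Finset.sum_nonneg fun i _ => xi_nonneg hβ₁ (hp i).fst_nonneg
  have n2 : 0 ≤ ∑ i ∈ Finset.range (p.1 - 1), xi β₂ (p.2 i).2 :=
    Finset.sum_nonneg fun i _ => xi_nonneg hβ₂ (hp i).snd_nonneg
  refine ⟨add_nonneg hB n1, add_nonneg hB n2, ?_, ?_⟩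
  · refine mul_xi_add_le_xi_add hβ₂ hB n1 hr hr' hr₁ ht ht' hc hc₂ ?_ n2
    rw [Finset.mul_sum]
    exact Finset.sum_le_sum fun i _ => (hp i).le_fst
  · refine mul_xi_add_le_xi_add hβ₁ hB n2 hr hr' hr₂ ht ht' hc hc₁ ?_ n1
    rw [Finset.mul_sum]
    exact Finset.sum_le_sum fun i _ => (hp i).le_snd

/-- Two messages bounded by `M` and within a factor `t` of each other differ by at most `M * (1 -
t)`; `tanh` is 1-Lipschitz. -/
theorem abs_tanh_pairField_sub_le {β₁ β₂ B t M : ℝ} (hβ₁ : 0 ≤ β₁) (hβ₂ : 0 ≤ β₂) (hM₁ : β₁ ≤ M)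
    (hM₂ : β₂ ≤ M) (ht' : t ≤ 1) {p : ℕ × (ℕ → ℝ × ℝ)}
    (hp : ∀ i, MessagesWithin β₁ β₂ t (p.2 i)) :
    |tanh (pairField β₁ β₂ B p).2 - tanh (pairField β₁ β₂ B p).1|
      ≤ ((p.1 - 1 : ℕ) : ℝ) * (M * (1 - t)) := by
  refine (abs_tanh_sub_tanh_le _ _).trans ?_
  rw [pairField, add_sub_add_left_eq_sub, ← Finset.sum_sub_distrib]
  refine (Finset.abs_sum_le_sum_abs _ _).trans ?_
  rw [← nsmul_eq_mul]
  conv_rhs => rw [← Finset.card_range (p.1 - 1)]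
  refine Finset.sum_le_card_nsmul _ _ _ fun i _ => ?_
  have h1 := (xi_le_left hβ₁ (p.2 i).1).trans hM₁
  have h2 := (xi_le_left hβ₂ (p.2 i).2).trans hM₂
  have h3 := (hp i).le_fst
  have h4 := (hp i).le_snd
  have ht0 := sub_nonneg.2 ht'
  rw [abs_le]
  constructor
  · nlinarith [mul_le_mul_of_nonneg_right h1 ht0]
  · nlinarith [mul_le_mul_of_nonneg_right h2 ht0]

/-- The comparison ratio after `n` steps of the recursion, started from the trivial one. -/
noncomputable def ratio (r c : ℝ) : ℕ → ℝ
  | 0 => 0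
  | n + 1 => r * (ratio r c n + (1 - ratio r c n) * c)

theorem ratio_mem {r c : ℝ} (hr : 0 ≤ r) (hr' : r ≤ 1) (hc : 0 ≤ c) (hc' : c ≤ 1) (n : ℕ) :
    0 ≤ ratio r c n ∧ ratio r c n ≤ 1 := by
  induction n with
  | zero => simp [ratio]
  | succ n ih =>
    obtain ⟨h0, h1⟩ := ih
    have h2 : 0 ≤ (1 - ratio r c n) * c := mul_nonneg (by linarith) hc
    have h3 : (1 - ratio r c n) * c ≤ 1 - ratio r c n :=
      mul_le_of_le_one_right (by linarith) hc'
    exact ⟨mul_nonneg hr (by linarith), mul_le_one₀ hr' (by linarith) (by linarith)⟩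

/-- The defect `x = 1 - t` evolves by `x ↦ (1 - r) + r (1 - c) x`, at most `(1 - r) + (1 - c) x`,
whose fixed point is `(1 - r) / c`. -/
theorem one_sub_ratio_le {r c : ℝ} (hr' : r ≤ 1) (hr : 0 ≤ r) (hc : 0 < c) (hc' : c ≤ 1) (n : ℕ) :
    1 - ratio r c n ≤ (1 - r) / c + (1 - c) ^ n := by
  induction n with
  | zero =>
    have : 0 ≤ (1 - r) / c := div_nonneg (by linarith) hc.le
    simpa [ratio] using this
  | succ n ih =>
    obtain ⟨h0, h1⟩ := ratio_mem hr hr' hc.le hc' n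
    have e : (1 - r) / c = (1 - r) + (1 - c) * ((1 - r) / c) := by field_simp; ring
    have h2 := mul_le_mul_of_nonneg_left ih (sub_nonneg.2 hc')
    have h3 : 0 ≤ (1 - c) * (1 - ratio r c n) := mul_nonneg (by linarith) (by linarith)
    have h4 : r * ((1 - c) * (1 - ratio r c n)) ≤ (1 - c) * (1 - ratio r c n) :=
      mul_le_of_le_one_left h3 hr'
    rw [ratio, pow_succ]
    nlinarith

variable {β₁ β₂ B r c M : ℝ} {ρ : PMF ℕ} {Q₁ Q₂ : Measure ℝ} [IsProbabilityMeasure Q₁]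
  [IsProbabilityMeasure Q₂]

theorem exists_coupling_messagesWithin (hβ₁ : 0 ≤ β₁) (hβ₂ : 0 ≤ β₂) (hB : 0 ≤ B)
    (hr : 0 ≤ r) (hr' : r ≤ 1) (hr₁ : r * β₂ ≤ β₁) (hr₂ : r * β₁ ≤ β₂) (hc : 0 ≤ c) (hc' : c ≤ 1)
    (hc₁ : c * β₁ ≤ xi β₁ B) (hc₂ : c * β₂ ≤ xi β₂ B) (hQ₁ : IsCavityFixedPoint β₁ B ρ Q₁)
    (hQ₂ : IsCavityFixedPoint β₂ B ρ Q₂) (n : ℕ) :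
    ∃ κ : Measure (ℝ × ℝ), IsProbabilityMeasure κ ∧ κ.map Prod.fst = Q₁ ∧ κ.map Prod.snd = Q₂ ∧
      ∀ᵐ q ∂κ, MessagesWithin β₁ β₂ (ratio r c n) q := by
  induction n with
  | zero =>
    have ae_nonneg : ∀ {Q : Measure ℝ}, Q (Set.Iio 0) = 0 → ∀ᵐ x ∂Q, 0 ≤ x := fun h => by
      rw [ae_iff]; simpa [Set.Iio] using h
    refine ⟨Q₁.prod Q₂, inferInstance, by simp, by simp, ?_⟩
    filter_upwards [Measure.quasiMeasurePreserving_fst.ae (ae_nonneg hQ₁.supported),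
      Measure.quasiMeasurePreserving_snd.ae (ae_nonneg hQ₂.supported)] with q h1 h2
    exact ⟨h1, h2, by simpa [ratio] using xi_nonneg hβ₁ h1, by simpa [ratio] using xi_nonneg hβ₂ h2⟩
  | succ n ih =>
    obtain ⟨κ, h_prob, h1, h2, h⟩ := ih
    obtain ⟨ht, ht'⟩ := ratio_mem hr hr' hc hc' n
    refine ⟨pairUpdate β₁ β₂ B ρ κ, inferInstance, pairUpdate_map_fst hQ₁.fixed h1,
      pairUpdate_map_snd hQ₂.fixed h2, ?_⟩
    rw [pairUpdate, ae_map_iff (measurable_pairField β₁ β₂ B).aemeasurable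
      (measurableSet_messagesWithin _ _ _)]
    filter_upwards [ae_forall_snd h] with p hp
    exact messagesWithin_pairField hβ₁ hβ₂ hB hr hr' hr₁ hr₂ ht ht' hc hc₁ hc₂ hp

theorem lintegral_card_sub_one (ρ : PMF ℕ) :
    ∫⁻ k, ((k - 1 : ℕ) : ℝ≥0∞) ∂ρ.toMeasure = meanBranching ρ := by
  rw [lintegral_countable', meanBranching]
  refine tsum_congr fun k => ?_
  rw [PMF.toMeasure_apply_singleton _ _ (measurableSet_singleton k), mul_comm]

theorem mkDist_map_tanh_le (hβ₁ : 0 ≤ β₁) (hβ₂ : 0 ≤ β₂) (hM₁ : β₁ ≤ M) (hM₂ : β₂ ≤ M)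
    {t : ℝ} (ht' : t ≤ 1) (hQ₁ : IsCavityFixedPoint β₁ B ρ Q₁)
    (hQ₂ : IsCavityFixedPoint β₂ B ρ Q₂) {κ : Measure (ℝ × ℝ)} [IsProbabilityMeasure κ]
    (h1 : κ.map Prod.fst = Q₁) (h2 : κ.map Prod.snd = Q₂)
    (h : ∀ᵐ q ∂κ, MessagesWithin β₁ β₂ t q) :
    mkDist (Q₂.map tanh) (Q₁.map tanh)
      ≤ meanBranching ρ * ENNReal.ofReal (M * (1 - t)) := by
  have mt := continuous_tanh.measurable
  have mg : Measurable fun q : ℝ × ℝ => (tanh q.2, tanh q.1) := by fun_prop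
  refine (iInf₂_le ((pairUpdate β₁ β₂ B ρ κ).map fun q => (tanh q.2, tanh q.1))
    ⟨?fst, ?snd⟩).trans ?bound
  case fst =>
    rw [Measure.map_map measurable_fst mg, ← pairUpdate_map_snd (β₁ := β₁) hQ₂.fixed h2,
      Measure.map_map mt measurable_snd]
    rfl
  case snd =>
    rw [Measure.map_map measurable_snd mg, ← pairUpdate_map_fst (β₂ := β₂) hQ₁.fixed h1,
      Measure.map_map mt measurable_fst]
    rfl
  case bound =>
    rw [lintegral_map (by fun_prop) mg, pairUpdate,
      lintegral_map (by fun_prop) (measurable_pairField β₁ β₂ B)]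
    have mk : Measurable fun k : ℕ => ((k - 1 : ℕ) : ℝ≥0∞) := measurable_of_countable _
    calc _ ≤ ∫⁻ p : ℕ × (ℕ → ℝ × ℝ), ((p.1 - 1 : ℕ) : ℝ≥0∞) * ENNReal.ofReal (M * (1 - t))
          ∂(ρ.toMeasure.prod (Measure.infinitePi fun _ : ℕ => κ)) := by
          refine lintegral_mono_ae ?_
          filter_upwards [ae_forall_snd h] with p hp
          refine (ENNReal.ofReal_le_ofReal
            (abs_tanh_pairField_sub_le hβ₁ hβ₂ hM₁ hM₂ ht' hp)).trans ?_
          rw [ENNReal.ofReal_mul (Nat.cast_nonneg _), ENNReal.ofReal_natCast]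
      _ = meanBranching ρ * ENNReal.ofReal (M * (1 - t)) := by
          have mk' : Measurable fun p : ℕ × (ℕ → ℝ × ℝ) => ((p.1 - 1 : ℕ) : ℝ≥0∞) :=
            mk.comp measurable_fst
          rw [lintegral_mul_const _ mk', ← lintegral_card_sub_one,
            ← (measurePreserving_fst (μ := ρ.toMeasure)
              (ν := Measure.infinitePi fun _ : ℕ => κ)).lintegral_comp mk]

end Coupling

end IsingTree

theorem mainTheorem9 (B : ℝ) (hB : 0 < B) (βmax : ℝ) (Δ : ℝ≥0) :
    ∃ C : ℝ≥0, ∀ ρ : PMF ℕ, ρ 0 = 0 → IsingTree.meanBranching ρ ≤ Δ →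
      ∀ β₁ β₂ : ℝ, 0 ≤ β₁ → β₁ ≤ βmax → 0 ≤ β₂ → β₂ ≤ βmax →
        ∀ (Q₁ Q₂ : Measure ℝ) [IsProbabilityMeasure Q₁] [IsProbabilityMeasure Q₂],
          IsingTree.IsCavityFixedPoint β₁ B ρ Q₁ → IsingTree.IsCavityFixedPoint β₂ B ρ Q₂ →
            IsingTree.mkDist (Q₂.map Real.tanh) (Q₁.map Real.tanh)
              ≤ C * ENNReal.ofReal |β₂ - β₁| := by
  open IsingTree in
  -- The maximum with `1` keeps the divisor in `c` positive when `βmax ≤ 0`.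
  have hN : 0 < max βmax 1 := lt_max_of_lt_right one_pos
  set c := xi (max βmax 1) B / max βmax 1 with hc_def
  have hc : 0 < c := div_pos (xi_pos hN hB) hN
  have hc' : c ≤ 1 := (div_le_one hN).2 (xi_le_left hN.le B)
  refine ⟨Δ * (1 / c).toNNReal, fun ρ _ hρ β₁ β₂ hβ₁ hm₁ hβ₂ hm₂ Q₁ Q₂ _ _ hQ₁ hQ₂ => ?_⟩
  have hc₁ : c * β₁ ≤ xi β₁ B := xi_div_mul_le hN hB.le hβ₁ (hm₁.trans (le_max_left _ _))
  have hc₂ : c * β₂ ≤ xi β₂ B := xi_div_mul_le hN hB.le hβ₂ (hm₂.trans (le_max_left _ _))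
  set M := max β₁ β₂ with hM_def
  obtain ⟨r, hr, hr', hr₁, hr₂, hrM⟩ : ∃ r : ℝ, 0 ≤ r ∧ r ≤ 1 ∧ r * β₂ ≤ β₁ ∧ r * β₁ ≤ β₂ ∧
      M * (1 - r) = |β₂ - β₁| := by
    have hm0 : 0 ≤ min β₁ β₂ := le_min hβ₁ hβ₂
    have hM0 : 0 ≤ M := hβ₁.trans (le_max_left _ _)
    have hmM : min β₁ β₂ ≤ M := min_le_max
    have hr0 : 0 ≤ min β₁ β₂ / M := div_nonneg hm0 hM0
    have e : min β₁ β₂ / M * M = min β₁ β₂ := by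
      -- If `M = 0`, both temperatures vanish and `r` is `0 / 0 = 0`, which still works.
      rcases hM0.eq_or_lt with h | h
      · rw [← h] at hmM ⊢
        rw [mul_zero]; linarith
      · exact div_mul_cancel₀ _ h.ne'
    refine ⟨min β₁ β₂ / M, hr0, div_le_one_of_le₀ hmM hM0, ?_, ?_, ?_⟩
    · exact (mul_le_mul_of_nonneg_left (le_max_right _ _) hr0).trans (e.le.trans (min_le_left _ _))
    · exact (mul_le_mul_of_nonneg_left (le_max_left _ _) hr0).trans (e.le.trans (min_le_right _ _))
    · rw [abs_sub_comm, ← max_sub_min_eq_abs']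
      linarith
  have hM0 : 0 ≤ M := hβ₁.trans (le_max_left _ _)
  have step : ∀ n : ℕ, mkDist (Q₂.map Real.tanh) (Q₁.map Real.tanh)
      ≤ Δ * ENNReal.ofReal (|β₂ - β₁| / c + M * (1 - c) ^ n) := fun n => by
    obtain ⟨κ, h_prob, h1, h2, h⟩ := exists_coupling_messagesWithin hβ₁ hβ₂ hB.le hr hr' hr₁ hr₂
      hc.le hc' hc₁ hc₂ hQ₁ hQ₂ n
    refine (mkDist_map_tanh_le hβ₁ hβ₂ (le_max_left _ _) (le_max_right _ _)
      (ratio_mem hr hr' hc.le hc' n).2 hQ₁ hQ₂ h1 h2 h).trans ?_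
    refine mul_le_mul' hρ (ENNReal.ofReal_le_ofReal ?_)
    calc M * (1 - ratio r c n) ≤ M * ((1 - r) / c + (1 - c) ^ n) :=
          mul_le_mul_of_nonneg_left (one_sub_ratio_le hr' hr hc hc' n) hM0
      _ = |β₂ - β₁| / c + M * (1 - c) ^ n := by rw [← hrM]; ring
  have lim : Filter.Tendsto
      (fun n : ℕ => (Δ : ℝ≥0∞) * ENNReal.ofReal (|β₂ - β₁| / c + M * (1 - c) ^ n)) Filter.atTop
      (nhds (Δ * ENNReal.ofReal (|β₂ - β₁| / c + M * 0))) := by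
    refine ENNReal.Tendsto.const_mul (ENNReal.tendsto_ofReal ?_) (Or.inr ENNReal.coe_ne_top)
    exact tendsto_const_nhds.add ((tendsto_pow_atTop_nhds_zero_of_lt_one (by linarith)
      (by linarith)).const_mul M)
  refine (ge_of_tendsto' lim step).trans_eq ?_
  rw [mul_zero, add_zero, ENNReal.coe_mul, mul_assoc, ENNReal.ofNNReal_toNNReal,
    ← ENNReal.ofReal_mul (by positivity), one_div_mul_eq_div]
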